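/- Let $d\ge 1$, let $\boldsymbol s=(s_1,\dots,s_d)$ be a tuple of positive integers, and let $a\in\mathbb R$ with $|a|\le 1$. Write $|\boldsymbol s|_r=s_1+\cdots+s_r$ (so $|\boldsymbol s|_0=0$) and $|\boldsymbol s|=|\boldsymbol s|_d$. For integers $n_1\ge\cdots\ge n_{|\boldsymbol s|+1}\ge 1$ put $$Q(\boldsymbol s)=\sum_{r=1}^d\bigl(n_{|\boldsymbol s|_{r-1}+1}-n_{|\boldsymbol s|_r}\bigr).$$ The value of a nested series $\sum_{n_1\ge\cdots\ge n_k\ge 1}f(n_1,\dots,n_k)$ is understood as the limit for $N\to\infty$ of its partial sums over $N\ge n_1\ge\cdots\ge n_k\ge 1$. If the multiple polylogarithm $$\mathrm{Li}^\star_{\boldsymbol s}(\{1\}_{d-1},a)=\sum_{n_1\ge\cdots\ge n_d\ge 1}\frac{a^{n_d}}{n_1^{s_1}\cdots n_d^{s_d}}$$ converges, then the nested series on the right-hand side below converges as well, and $$\mathrm{Li}^\star_{\boldsymbol s}(\{1\}_{d-1},a)=\sum_{n_1\ge\cdots\ge n_{|\boldsymbol s|+1}\ge 1}\frac{\binom{n_{|\boldsymbol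 s|}}{n_{|\boldsymbol s|+1}}}{\binom{Q(\boldsymbol s)+n_{|\boldsymbol s|}}{n_{|\boldsymbol s|+1}}}\cdot\frac{a^{n_{|\boldsymbol s|+1}}}{(Q(\boldsymbol s)+n_{|\boldsymbol s|}+1)\,n_1\cdots n_{|\boldsymbol s|}}.$$ -/

import Mathlib

open Filter Topology

/-- The finite set of all integer tuples `(n_1, …, n_k)` with `N ≥ n_1 ≥ ⋯ ≥ n_k ≥ 1`;
the entry `n_j` is `n ⟨j - 1, _⟩`. -/
def chains (k N : ℕ) : Finset (Fin k → ℕ) :=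
  (Fintype.piFinset fun _ : Fin k => Finset.Icc 1 N).filter fun n => ∀ i j, i ≤ j → n j ≤ n i

/-- The nested series `∑_{n_1 ≥ ⋯ ≥ n_k ≥ 1} f (n_1, …, n_k)` converges with value `L`: its partial
sums over `N ≥ n_1 ≥ ⋯ ≥ n_k ≥ 1` tend to `L` as `N → ∞`. -/
def HasNestedSum {k : ℕ} (f : (Fin k → ℕ) → ℝ) (L : ℝ) : Prop :=
  Tendsto (fun N : ℕ => ∑ n ∈ chains k N, f n) atTop (𝓝 L)

/-- The multiple polylogarithm `Li^⋆_{s_1,…,s_d}(x_1,…,x_d) = ∑_{n_1 ≥ ⋯ ≥ n_d ≥ 1} ∏ x_i^{n_i} / n_i^{s_i}`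
converges and has the value `L`. -/
def HasLiStar {d : ℕ} (s : Fin d → ℕ) (x : Fin d → ℝ) (L : ℝ) : Prop :=
  HasNestedSum (fun n : Fin d → ℕ => ∏ i, x i ^ n i / (n i : ℝ) ^ s i) L

/-- The argument `({1}_{d-1}, a)`. -/
def onesThen (d : ℕ) (a : ℝ) : Fin d → ℝ :=
  fun i => if i.val + 1 = d then a else 1

/-- The weight `|s| = s_1 + ⋯ + s_d`. -/
def weight {d : ℕ} (s : Fin d → ℕ) : ℕ := ∑ i, s i

/-- The partial weight `|s|_r = s_1 + ⋯ + s_r`. -/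
def partialWeight {d : ℕ} (s : Fin d → ℕ) (r : ℕ) : ℕ :=
  ∑ i with i.val < r, s i

theorem partialWeight_le {d : ℕ} (s : Fin d → ℕ) (r : ℕ) : partialWeight s r ≤ weight s :=
  Finset.sum_le_sum_of_subset (Finset.filter_subset _ _)

theorem partialWeight_succ {d : ℕ} (s : Fin d → ℕ) (r : Fin d) :
    partialWeight s (r.val + 1) = partialWeight s r.val + s r := by
  unfold partialWeight
  have h : (Finset.univ.filter fun i : Fin d => i.val < r.val + 1)
      = insert r (Finset.univ.filter fun i : Fin d => i.val < r.val) := by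
    ext i
    simp only [Finset.mem_filter, Finset.mem_univ, true_and, Finset.mem_insert, Fin.ext_iff]
    omega
  rw [h, Finset.sum_insert (by simp), add_comm]

/-- `Q(s) = ∑_{r=1}^d (n_{|s|_{r-1}+1} - n_{|s|_r})` for a tuple `n = (n_1, …, n_{|s|+1})`. The
summation index `r` and the positions in `n` are shifted by one, as both start from `0` here.
If `n` is weakly decreasing and the `s_i` are positive, no subtraction truncates; see `Qs_cast`. -/
def Qs {d : ℕ} (s : Fin d → ℕ) (n : Fin (weight s + 1) → ℕ) : ℕ :=
  ∑ r : Fin d,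
    (n ⟨partialWeight s r.val, Nat.lt_succ_of_le (partialWeight_le s _)⟩
      - n ⟨partialWeight s (r.val + 1) - 1,
          Nat.lt_succ_of_le ((Nat.sub_le _ _).trans (partialWeight_le s _))⟩)

/-- On the tuples over which the series runs, `Qs` is the sum of the integer differences. -/
theorem Qs_cast {d : ℕ} (s : Fin d → ℕ) (hs : ∀ i, 1 ≤ s i) (N : ℕ)
    (n : Fin (weight s + 1) → ℕ) (hn : n ∈ chains (weight s + 1) N) :
    (Qs s n : ℤ) = ∑ r : Fin d,
      ((n ⟨partialWeight s r.val, Nat.lt_succ_of_le (partialWeight_le s _)⟩ : ℤ)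
        - (n ⟨partialWeight s (r.val + 1) - 1,
            Nat.lt_succ_of_le ((Nat.sub_le _ _).trans (partialWeight_le s _))⟩ : ℤ)) := by
  unfold Qs
  rw [Nat.cast_sum]
  refine Finset.sum_congr rfl fun r _ => Nat.cast_sub ?_
  refine (Finset.mem_filter.1 hn).2 _ _ ?_
  have h1 := partialWeight_succ s r
  have h2 := hs r
  rw [Fin.mk_le_mk]
  omega

/-- For a tuple `n = (n_1, …, n_{|s|+1})`, the term
`binom(n_{|s|}, n_{|s|+1}) / binom(Q(s) + n_{|s|}, n_{|s|+1})
  * a^{n_{|s|+1}} / ((Q(s) + n_{|s|} + 1) * n_1 ⋯ n_{|s|})`. -/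
noncomputable def meanTerm {d : ℕ} (s : Fin d → ℕ) (a : ℝ) (n : Fin (weight s + 1) → ℕ) : ℝ :=
  let u : ℕ := n ⟨weight s - 1, Nat.lt_succ_of_le (Nat.sub_le _ _)⟩
  let v : ℕ := n (Fin.last (weight s))
  ((u.choose v : ℝ) / ((Qs s n + u).choose v : ℝ))
    * (a ^ v / (((Qs s n : ℝ) + u + 1) * ∏ i : Fin (weight s), (n i.castSucc : ℝ)))

/-! The partial sum of the right-hand series up to N is exactly the Cesàro mean of the truncated
polylogarithms with bounds M = 0, …, N, so convergence and value follow from Cesàro's theorem.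

The identity is proved one index at a time. Read s as a word of length |s|, each block being one
`true` followed by `false`s. While the word is read, c accumulates the drops inside blocks, which
finally gives Q(s). By `wordSum_eq`, the nested sum with parameters c, b is the average of the
truncated polylogarithms against `betaKernel c b`. Each letter needs one summation rule for the
kernel: `sum_betaKernel_div_of_add_const` turns `false` into division by v, and `sum_betaKernel_div`
turns `true` into a new summation. At c = 0 the kernel is the constant 1/(b+1), hence the Cesàro
mean. -/

/-! ### The beta kernel and its summation rules -/

/-- The kernel `binom b v / ((c + b + 1) * binom (c + b) v)`, that is, the integral of
`binom b v * x ^ v * (1 - x) ^ (c + b - v)` over the unit interval when `v ≤ b`. -/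
noncomputable def betaKernel (c b v : ℕ) : ℝ :=
  (b.choose v : ℝ) / (((c + b : ℕ) + 1 : ℝ) * ((c + b).choose v : ℝ))

theorem betaKernel_eq_zero {c b v : ℕ} (h : b < v) : betaKernel c b v = 0 := by
  simp [betaKernel, Nat.choose_eq_zero_of_lt h]

theorem betaKernel_zero_left {b v : ℕ} (h : v ≤ b) : betaKernel 0 b v = 1 / ((b : ℝ) + 1) := by
  have h1 : ((b.choose v : ℕ) : ℝ) ≠ 0 := by exact_mod_cast (Nat.choose_pos h).ne'
  have h2 : (b : ℝ) + 1 ≠ 0 := by positivity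
  simp only [betaKernel, zero_add]
  field_simp

theorem betaKernel_add (c e v : ℕ) :
    betaKernel c (v + e) v = ((v + e).factorial * (c + e).factorial : ℝ) /
      (e.factorial * (c + v + e + 1).factorial) := by
  have h1 : (((v + e).choose v : ℕ) : ℝ) = (v + e).factorial / (v.factorial * e.factorial) := by
    rw [Nat.cast_choose ℝ (Nat.le_add_right v e), Nat.add_sub_cancel_left]
  have h2 : (((c + (v + e)).choose v : ℕ) : ℝ)
      = (c + v + e).factorial / (v.factorial * (c + e).factorial) := by
    rw [Nat.cast_choose ℝ (by omega), show c + (v + e) - v = c + e by omega,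
      show c + (v + e) = c + v + e by omega]
  have p := fun k : ℕ => (Nat.cast_ne_zero (R := ℝ)).2 k.factorial_ne_zero
  have p1 := p v
  have p2 := p e
  have p3 := p (c + e)
  have p4 := p (c + v + e)
  have p5 : ((c + (v + e) : ℕ) : ℝ) + 1 ≠ 0 := by positivity
  have h3 : ((c + v + e + 1).factorial : ℝ)
      = (((c + (v + e) : ℕ) : ℝ) + 1) * (c + v + e).factorial := by
    rw [Nat.factorial_succ]; push_cast; ring
  rw [betaKernel, h1, h2, h3]
  field_simp

/-- Under the integral, this is Pascal's rule for the Bernstein polynomials, together with (b+1)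
binom(b, v-1) = v binom(b+1, v); the factor (1-x)^c is inert. -/
theorem betaKernel_succ_sub (c b v : ℕ) :
    ((b : ℝ) + 1) * (betaKernel c (b + 1) v - betaKernel c b v) =
      v * betaKernel c (b + 1) v - (v + 1 : ℕ) * betaKernel c (b + 1) (v + 1) := by
  rcases lt_trichotomy v (b + 1) with h | h | h
  · obtain ⟨e, rfl⟩ := Nat.exists_eq_add_of_le (Nat.lt_succ_iff.1 h)
    rw [show v + e + 1 = v + (e + 1) by omega, betaKernel_add, betaKernel_add,
      show v + (e + 1) = (v + 1) + e by omega, betaKernel_add,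
      show v + 1 + e = (v + e) + 1 by omega, show c + (e + 1) = (c + e) + 1 by omega,
      show c + (v + 1) + e + 1 = c + v + e + 1 + 1 by omega,
      show c + v + (e + 1) + 1 = c + v + e + 1 + 1 by omega,
      Nat.factorial_succ (v + e), Nat.factorial_succ (c + e), Nat.factorial_succ e,
      Nat.factorial_succ (c + v + e + 1)]
    have p := fun k : ℕ => (Nat.cast_ne_zero (R := ℝ)).2 k.factorial_ne_zero
    have p2 := p e
    have p3 := p (c + e)
    have p4 := p (c + v + e + 1)
    have p5 := p (v + e)
    have p6 : (c : ℝ) + v + e + 1 + 1 ≠ 0 := by positivity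
    have p7 : (e : ℝ) + 1 ≠ 0 := by positivity
    push_cast
    field_simp
    ring
  · subst h
    rw [betaKernel_eq_zero (show b < b + 1 by omega),
      betaKernel_eq_zero (show b + 1 < b + 1 + 1 by omega)]
    push_cast
    ring
  · rw [betaKernel_eq_zero h, betaKernel_eq_zero (show b < v by omega),
      betaKernel_eq_zero (show b + 1 < v + 1 by omega)]
    ring

theorem sum_Icc_one_choose_pred (b v : ℕ) :
    ∑ k ∈ Finset.Icc 1 b, (k - 1).choose v = b.choose (v + 1) := by
  induction b with
  | zero => simp
  | succ b ih =>
    rw [Finset.sum_Icc_succ_top (by omega), ih, Nat.choose_succ_succ, add_comm]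
    simp

theorem choose_div_self {k v : ℕ} (hk : 1 ≤ k) (hv : 1 ≤ v) :
    (k.choose v : ℝ) / k = ((k - 1).choose (v - 1) : ℝ) / v := by
  obtain ⟨k, rfl⟩ := Nat.exists_eq_add_of_le' hk
  obtain ⟨v, rfl⟩ := Nat.exists_eq_add_of_le' hv
  have h : ((k + 1 : ℕ) : ℝ) * k.choose v = (k + 1).choose (v + 1) * (v + 1 : ℕ) := by
    exact_mod_cast Nat.add_one_mul_choose_eq k v
  rw [div_eq_div_iff (by positivity) (by positivity), ← h]
  simp [mul_comm]

/-- Summing the kernel along a step that keeps `c + b` fixed. -/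
theorem sum_betaKernel_div_of_add_const (c b : ℕ) {v : ℕ} (hv : 1 ≤ v) :
    ∑ k ∈ Finset.Icc 1 b, betaKernel (c + (b - k)) k v / k = betaKernel c b v / v := by
  -- As c + b is fixed, the denominator does not depend on k; what remains is a hockey-stick sum.
  have h : ∀ k ∈ Finset.Icc 1 b, betaKernel (c + (b - k)) k v / k =
      ((k - 1).choose (v - 1) : ℝ) * (1 / (v * (((c + b : ℕ) + 1 : ℝ) * (c + b).choose v))) := by
    intro k hk
    obtain ⟨h1, h2⟩ := Finset.mem_Icc.1 hk
    rw [betaKernel, show c + (b - k) + k = c + b by omega, div_right_comm, choose_div_self h1 hv,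
      div_div, mul_one_div]
  rw [Finset.sum_congr rfl h, ← Finset.sum_mul, ← Nat.cast_sum, sum_Icc_one_choose_pred,
    Nat.sub_add_cancel hv, betaKernel, mul_one_div, div_div, mul_comm (v : ℝ)]

theorem sum_betaKernel_succ_sub (c b : ℕ) {v M : ℕ} (hM : v ≤ M) :
    ((b : ℝ) + 1) * ∑ k ∈ Finset.Ico v M, (betaKernel c (b + 1) k - betaKernel c b k) =
      v * betaKernel c (b + 1) v - M * betaKernel c (b + 1) M := by
  induction M, hM using Nat.le_induction with
  | base => simp
  | succ M hM ih =>
    rw [Finset.sum_Ico_succ_top hM, mul_add, ih, betaKernel_succ_sub]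
    ring

/-- Summing the kernel along a step that keeps `c` fixed: the tail of a binomial distribution is
a partial sum of a negative binomial one. -/
theorem sum_betaKernel_div (c b : ℕ) {v : ℕ} (hv : 1 ≤ v) :
    ∑ k ∈ Finset.Icc 1 b, betaKernel c k v / k = (∑ w ∈ Finset.Icc v b, betaKernel c b w) / v := by
  have hv0 : (v : ℝ) ≠ 0 := by positivity
  induction b with
  | zero => simp [Finset.Icc_eq_empty (show ¬ v ≤ 0 by omega)]
  | succ b ih =>
    rw [Finset.sum_Icc_succ_top (by omega), ih]
    by_cases hvb : v ≤ b + 1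
    · have h := sum_betaKernel_succ_sub c b (show v ≤ b + 2 by omega)
      rw [betaKernel_eq_zero (show b + 1 < b + 2 by omega), Finset.sum_sub_distrib] at h
      have h1 : Finset.Ico v (b + 2) = Finset.Icc v (b + 1) := by ext; simp; omega
      rw [h1, Finset.sum_Icc_succ_top hvb (fun w => betaKernel c b w),
        betaKernel_eq_zero (show b < b + 1 by omega)] at h
      have hb : (b : ℝ) + 1 ≠ 0 := by positivity
      push_cast
      field_simp
      linarith
    · rw [Finset.Icc_eq_empty hvb, Finset.Icc_eq_empty (show ¬ v ≤ b by omega),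
        betaKernel_eq_zero (by omega)]
      simp

/-! ### Words, and the averaging identity -/

/-- Nested sums steered by a word: the letter `true` starts a new block of indices, the letter
`false` stays in the current block and adds the drop of the index to `c`. -/
noncomputable def wordSum (a : ℝ) : List Bool → ℕ → ℕ → ℝ
  | [], c, b => ∑ v ∈ Finset.Icc 1 b, betaKernel c b v * a ^ v
  | false :: w, c, b => ∑ k ∈ Finset.Icc 1 b, wordSum a w (c + (b - k)) k / k
  | true :: w, c, b => ∑ k ∈ Finset.Icc 1 b, wordSum a w c k / k

/-- The truncated multiple polylogarithm attached to a word. -/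
noncomputable def wordLi (a : ℝ) : List Bool → ℕ → ℝ
  | [], v => a ^ v
  | false :: w, v => wordLi a w v / v
  | true :: w, v => ∑ k ∈ Finset.Icc 1 v, wordLi a w k / k

/-- The kernel vanishes for v > k, so the triangle v ≤ k can be completed to a square and the sums
exchanged. Letting c depend on k covers both letters. -/
theorem sum_sum_betaKernel (c : ℕ → ℕ) (b : ℕ) (X : ℕ → ℝ) :
    ∑ k ∈ Finset.Icc 1 b, (∑ v ∈ Finset.Icc 1 k, betaKernel (c k) k v * X v) / k =
      ∑ v ∈ Finset.Icc 1 b, (∑ k ∈ Finset.Icc 1 b, betaKernel (c k) k v / k) * X v := by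
  have h : ∀ k ∈ Finset.Icc 1 b, (∑ v ∈ Finset.Icc 1 k, betaKernel (c k) k v * X v) / k =
      ∑ v ∈ Finset.Icc 1 b, betaKernel (c k) k v / k * X v := by
    intro k hk
    rw [Finset.sum_div]
    refine (Finset.sum_congr rfl fun v _ => by ring).trans
      (Finset.sum_subset (Finset.Icc_subset_Icc_right (Finset.mem_Icc.1 hk).2) ?_)
    intro v hv hv'
    simp only [Finset.mem_Icc] at hv hv'
    rw [betaKernel_eq_zero (by omega)]
    simp
  rw [Finset.sum_congr rfl h, Finset.sum_comm]
  simp only [Finset.sum_mul]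

theorem wordSum_eq (a : ℝ) (w : List Bool) (c b : ℕ) :
    wordSum a w c b = ∑ v ∈ Finset.Icc 1 b, betaKernel c b v * wordLi a w v := by
  induction w generalizing c b with
  | nil => rfl
  | cons x w ih =>
    cases x with
    | false =>
      simp only [wordSum, wordLi, ih]
      rw [sum_sum_betaKernel (fun k => c + (b - k))]
      refine Finset.sum_congr rfl fun v hv => ?_
      rw [sum_betaKernel_div_of_add_const c b (Finset.mem_Icc.1 hv).1]
      ring
    | true =>
      simp only [wordSum, wordLi, ih]
      rw [sum_sum_betaKernel (fun _ => c)]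
      simp only [Finset.mul_sum]
      rw [Finset.sum_comm' (t' := Finset.Icc 1 b) (s' := fun v => Finset.Icc v b)
        (by intro x y; simp only [Finset.mem_Icc]; omega)]
      refine Finset.sum_congr rfl fun v hv => ?_
      rw [sum_betaKernel_div c b (Finset.mem_Icc.1 hv).1, ← Finset.sum_mul]
      ring

/-! ### Chains of indices as sequences -/

/-- Prepend an entry to a sequence. -/
def seqCons (m : ℕ) (g : ℕ → ℕ) : ℕ → ℕ
  | 0 => m
  | i + 1 => g i

/-- Extend a tuple by zeros to a sequence. -/
def extendZero {k : ℕ} (n : Fin k → ℕ) (i : ℕ) : ℕ :=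
  if h : i < k then n ⟨i, h⟩ else 0

theorem extendZero_cons {k : ℕ} (m : ℕ) (n : Fin k → ℕ) :
    extendZero (Fin.cons m n : Fin (k + 1) → ℕ) = seqCons m (extendZero n) := by
  funext i
  cases i with
  | zero => simp [extendZero, seqCons]
  | succ i =>
    by_cases h : i < k
    · simp only [extendZero, seqCons, h, Nat.succ_lt_succ h, dif_pos]
      exact Fin.cons_succ (α := fun _ => ℕ) m n ⟨i, h⟩
    · simp [extendZero, seqCons, h]

theorem mem_chains {k N : ℕ} {n : Fin k → ℕ} :
    n ∈ chains k N ↔ (∀ i, 1 ≤ n i ∧ n i ≤ N) ∧ ∀ i j, i ≤ j → n j ≤ n i := by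
  simp [chains]

theorem cons_mem_chains {k N m : ℕ} {n : Fin k → ℕ} :
    (Fin.cons m n : Fin (k + 1) → ℕ) ∈ chains (k + 1) N ↔
      m ∈ Finset.Icc 1 N ∧ n ∈ chains k m := by
  simp only [mem_chains, Fin.forall_fin_succ, Fin.cons_zero, Fin.cons_succ, Finset.mem_Icc]
  constructor
  · rintro ⟨⟨h1, h2⟩, ⟨-, h3⟩, h4⟩
    exact ⟨h1, fun i => ⟨(h2 i).1, h3 i (Fin.zero_le _)⟩,
      fun i j hij => (h4 i).2 j (Fin.succ_le_succ_iff.2 hij)⟩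
  · rintro ⟨h1, h2, h3⟩
    refine ⟨⟨h1, fun i => ⟨(h2 i).1, (h2 i).2.trans h1.2⟩⟩, ⟨fun _ => le_rfl, fun i _ => (h2 i).2⟩,
      fun i => ⟨fun h => absurd h (by simp), fun j hij => h3 i j (Fin.succ_le_succ_iff.1 hij)⟩⟩

theorem sum_chains_succ (k N : ℕ) (f : (Fin (k + 1) → ℕ) → ℝ) :
    ∑ n ∈ chains (k + 1) N, f n =
      ∑ m ∈ Finset.Icc 1 N, ∑ n ∈ chains k m, f (Fin.cons m n) := by
  rw [Finset.sum_sigma']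
  refine Finset.sum_bij' (fun n _ => ⟨n 0, Fin.tail n⟩)
    (fun p _ => (Fin.cons p.1 p.2 : Fin (k + 1) → ℕ)) ?_ ?_ ?_ ?_ ?_
  · intro n hn
    rw [Finset.mem_sigma, ← cons_mem_chains]
    simpa using hn
  · intro p hp
    exact cons_mem_chains.2 (Finset.mem_sigma.1 hp)
  · intro n _
    simp
  · intro p _
    simp
  · intro n _
    simp

theorem sum_chains_zero (N : ℕ) (f : (Fin 0 → ℕ) → ℝ) : ∑ n ∈ chains 0 N, f n = f Fin.elim0 := by
  have h : chains 0 N = {Fin.elim0} := by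
    ext n
    simp [mem_chains, Subsingleton.elim n Fin.elim0]
  rw [h, Finset.sum_singleton]

theorem antitone_extendZero {k N : ℕ} {n : Fin k → ℕ} (hn : n ∈ chains k N) :
    Antitone (extendZero n) := by
  intro i j hij
  unfold extendZero
  split_ifs with h1 h2
  · exact (mem_chains.1 hn).2 _ _ hij
  · omega
  · exact Nat.zero_le _
  · exact le_rfl

/-- The term of the nested sum `wordSum`, as a function of the sequence of all indices, which
starts with the upper bound. -/
noncomputable def wordTerm (a : ℝ) : List Bool → ℕ → (ℕ → ℕ) → ℝ
  | [], c, g => betaKernel c (g 0) (g 1) * a ^ g 1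
  | false :: w, c, g => wordTerm a w (c + (g 0 - g 1)) (fun i => g (i + 1)) / g 1
  | true :: w, c, g => wordTerm a w c (fun i => g (i + 1)) / g 1

theorem wordSum_eq_sum_chains (a : ℝ) (w : List Bool) (c b : ℕ) :
    wordSum a w c b =
      ∑ n ∈ chains (w.length + 1) b, wordTerm a w c (seqCons b (extendZero n)) := by
  induction w generalizing c b with
  | nil =>
    rw [List.length_nil, sum_chains_succ]
    simp only [sum_chains_zero, extendZero_cons]
    rfl
  | cons x w ih =>
    rw [List.length_cons, sum_chains_succ]
    simp only [extendZero_cons]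
    cases x with
    | false =>
      simp only [wordSum, ih, Finset.sum_div]
      rfl
    | true =>
      simp only [wordSum, ih, Finset.sum_div]
      rfl

/-- The drops within a block telescope; antitonicity keeps the truncated subtractions exact. -/
theorem wordTerm_replicate (a : ℝ) (w : List Bool) (j c : ℕ) {g : ℕ → ℕ} (hg : Antitone g) :
    wordTerm a (List.replicate j false ++ w) c g =
      wordTerm a w (c + (g 0 - g j)) (fun i => g (i + j)) / ∏ i ∈ Finset.range j, (g (i + 1) : ℝ) := by
  induction j generalizing c g with
  | zero => simp
  | succ j ih =>
    have hg' : Antitone fun i => g (i + 1) := fun i k h => hg (Nat.succ_le_succ h)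
    have h1 : g 1 ≤ g 0 := hg zero_le_one
    have h2 : g (j + 1) ≤ g 1 := hg (by omega)
    rw [List.replicate_succ, List.cons_append, wordTerm, ih _ hg', Finset.prod_range_succ', div_div]
    simp only [zero_add]
    rw [show c + (g 0 - g 1) + (g 1 - g (j + 1)) = c + (g 0 - g (j + 1)) by omega]
    simp only [add_assoc, add_comm 1]

/-! ### The word of s and the terms of the two series -/

/-- The word whose blocks have the lengths `s_1, …, s_d`. -/
def blockWord : (d : ℕ) → (Fin d → ℕ) → List Bool
  | 0, _ => []
  | d + 1, s => true :: (List.replicate (s 0 - 1) false ++ blockWord d (Fin.tail s))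

theorem weight_succ {d : ℕ} (s : Fin (d + 1) → ℕ) : weight s = s 0 + weight (Fin.tail s) :=
  Fin.sum_univ_succ s

theorem partialWeight_tail {d : ℕ} (s : Fin (d + 1) → ℕ) (r : ℕ) :
    partialWeight s (r + 1) = s 0 + partialWeight (Fin.tail s) r := by
  unfold partialWeight
  rw [Finset.sum_filter, Fin.sum_univ_succ, Finset.sum_filter]
  simp [Fin.tail]

theorem length_blockWord (d : ℕ) (s : Fin d → ℕ) (hs : ∀ i, 1 ≤ s i) :
    (blockWord d s).length = weight s := by
  induction d with
  | zero => simp [blockWord, weight]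
  | succ d ih =>
    have h := hs 0
    rw [blockWord, List.length_cons, List.length_append, List.length_replicate,
      ih (Fin.tail s) fun i => hs i.succ, weight_succ]
    omega

/-- `Qs` as a function of a sequence. -/
def seqQs {d : ℕ} (s : Fin d → ℕ) (g : ℕ → ℕ) : ℕ :=
  ∑ r : Fin d, (g (partialWeight s r.val) - g (partialWeight s (r.val + 1) - 1))

theorem seqQs_succ {d : ℕ} (s : Fin (d + 1) → ℕ) (hs : ∀ i, 1 ≤ s i) (g : ℕ → ℕ) :
    seqQs s g = (g 0 - g (s 0 - 1)) + seqQs (Fin.tail s) (fun i => g (i + s 0)) := by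
  have h0 : ∀ {d : ℕ} (s : Fin d → ℕ), partialWeight s 0 = 0 := by simp [partialWeight]
  rw [seqQs, Fin.sum_univ_succ, seqQs]
  congr 1
  · rw [Fin.val_zero, partialWeight_tail, h0, h0, add_zero]
  · refine Finset.sum_congr rfl fun r _ => ?_
    have h1 := partialWeight_succ (Fin.tail s) r
    have h2 : 1 ≤ Fin.tail s r := hs r.succ
    rw [Fin.val_succ, partialWeight_tail, partialWeight_tail, add_comm (s 0), add_comm (s 0),
      Nat.sub_add_comm (by omega)]

theorem wordTerm_blockWord (a : ℝ) (d : ℕ) (s : Fin d → ℕ) (hs : ∀ i, 1 ≤ s i) (c : ℕ)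
    {g : ℕ → ℕ} (hg : Antitone g) :
    wordTerm a (blockWord d s) c g =
      betaKernel (c + seqQs s fun i => g (i + 1)) (g (weight s)) (g (weight s + 1))
        * a ^ g (weight s + 1) / ∏ i ∈ Finset.range (weight s), (g (i + 1) : ℝ) := by
  induction d generalizing c g with
  | zero => simp [blockWord, wordTerm, weight, seqQs]
  | succ d ih =>
    obtain ⟨j, hj⟩ := Nat.exists_eq_add_of_le' (hs 0)
    have hg' : ∀ k, Antitone fun i => g (i + k) := fun k i i' h => hg (Nat.add_le_add_right h k)
    rw [blockWord, wordTerm, wordTerm_replicate _ _ _ _ (hg' 1), ih (Fin.tail s) fun i => hs i.succ]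
    · rw [seqQs_succ s hs, weight_succ, hj, Nat.add_sub_cancel, add_comm (j + 1) (weight _),
        ← add_assoc (weight _) j 1, Finset.prod_range_succ', add_comm (weight _) j,
        Finset.prod_range_add]
      simp only [div_div, add_assoc, add_comm, add_left_comm, zero_add, mul_comm]
    · exact fun i i' h => hg' 1 (Nat.add_le_add_right h _)

/-- The prepended bound `N` leaves no trace: the word starts with `true`, so the drop from `N` to
the first index is never recorded. -/
theorem meanTerm_eq_wordTerm {d : ℕ} (hd : 1 ≤ d) (s : Fin d → ℕ) (hs : ∀ i, 1 ≤ s i) (a : ℝ)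
    (N : ℕ) (n : Fin (weight s + 1) → ℕ) (hn : n ∈ chains (weight s + 1) N) :
    meanTerm s a n = wordTerm a (blockWord d s) 0 (seqCons N (extendZero n)) := by
  have hg : Antitone (seqCons N (extendZero n)) := by
    rw [← extendZero_cons]
    by_cases hN : 1 ≤ N
    · exact antitone_extendZero (N := N) (cons_mem_chains.2 ⟨by simp [hN], hn⟩)
    · have := (mem_chains.1 hn).1 0
      omega
  -- Positive weight ensures that position `weight s` of the prepended sequence holds an entry of
  -- `n` and not the bound `N`.
  have hw : 1 ≤ weight s := (hs ⟨0, hd⟩).trans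
    (Finset.single_le_sum (f := s) (fun _ _ => Nat.zero_le _) (Finset.mem_univ _))
  rw [wordTerm_blockWord a d s hs 0 hg]
  have h1 : seqQs s (fun i => seqCons N (extendZero n) (i + 1)) = Qs s n := by
    refine Finset.sum_congr rfl fun r _ => ?_
    have h1 := partialWeight_le s r.val
    have h2 := partialWeight_le s (r.val + 1)
    simp only [seqCons, extendZero]
    rw [dif_pos (by omega), dif_pos (by omega)]
  have h2 : seqCons N (extendZero n) (weight s) = n ⟨weight s - 1, by omega⟩ := by
    have hc : ∀ (g : ℕ → ℕ) k, 1 ≤ k → seqCons N g k = g (k - 1) := by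
      rintro g (_ | k) hk
      · omega
      · rfl
    rw [hc _ _ hw, extendZero, dif_pos]
  have h3 : seqCons N (extendZero n) (weight s + 1) = n (Fin.last _) := by
    simp [seqCons, extendZero, Fin.last]
  have h4 : ∏ i ∈ Finset.range (weight s), (seqCons N (extendZero n) (i + 1) : ℝ)
      = ∏ i : Fin (weight s), (n i.castSucc : ℝ) := by
    rw [Finset.prod_range]
    refine Finset.prod_congr rfl fun i _ => ?_
    simp only [seqCons, extendZero]
    rw [dif_pos (by omega)]
    rfl
  rw [h1, h2, h3, h4, zero_add]
  simp only [meanTerm, betaKernel]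
  push_cast
  simp only [div_eq_mul_inv, mul_inv]
  ring

theorem wordLi_replicate (a : ℝ) (w : List Bool) (j v : ℕ) :
    wordLi a (List.replicate j false ++ w) v = wordLi a w v / (v : ℝ) ^ j := by
  induction j with
  | zero => simp
  | succ j ih => rw [List.replicate_succ, List.cons_append, wordLi, ih, div_div, pow_succ]

theorem wordLi_replicate_div (a : ℝ) (w : List Bool) {j : ℕ} (hj : 1 ≤ j) (v : ℕ) :
    wordLi a (List.replicate (j - 1) false ++ w) v / v = wordLi a w v / (v : ℝ) ^ j := by
  rw [wordLi_replicate, div_div, ← pow_succ, Nat.sub_add_cancel hj]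

theorem sum_chains_liTerm (a : ℝ) (d : ℕ) (s : Fin (d + 1) → ℕ) (hs : ∀ i, 1 ≤ s i) (N : ℕ) :
    ∑ n ∈ chains (d + 1) N, ∏ i, onesThen (d + 1) a i ^ n i / (n i : ℝ) ^ s i =
      wordLi a (blockWord (d + 1) s) N := by
  induction d generalizing N with
  | zero =>
    rw [sum_chains_succ, blockWord, wordLi]
    refine Finset.sum_congr rfl fun m _ => ?_
    rw [sum_chains_zero, wordLi_replicate_div a _ (hs 0)]
    simp [onesThen, blockWord, wordLi]
  | succ d ih =>
    rw [sum_chains_succ, blockWord, wordLi]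
    refine Finset.sum_congr rfl fun m _ => ?_
    rw [wordLi_replicate_div a _ (hs 0), ← ih (Fin.tail s) (fun i => hs i.succ), Finset.sum_div]
    refine Finset.sum_congr rfl fun n _ => ?_
    rw [Fin.prod_univ_succ]
    have h0 : onesThen (d + 1 + 1) a 0 = 1 := by simp [onesThen]
    have h1 : ∀ i : Fin (d + 1), onesThen (d + 1 + 1) a i.succ = onesThen (d + 1) a i := by
      intro i
      simp [onesThen]
    simp only [h0, h1, Fin.cons_zero, Fin.cons_succ, one_pow, Fin.tail]
    ring

/-- The partial sums of the nested series are the Cesàro means of the truncated multiple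
polylogarithms. -/
theorem sum_chains_meanTerm (a : ℝ) (d : ℕ) (s : Fin (d + 1) → ℕ) (hs : ∀ i, 1 ≤ s i) (N : ℕ) :
    ∑ n ∈ chains (weight s + 1) N, meanTerm s a n =
      ((N + 1 : ℕ) : ℝ)⁻¹ * ∑ M ∈ Finset.range (N + 1),
        ∑ n ∈ chains (d + 1) M, ∏ i, onesThen (d + 1) a i ^ n i / (n i : ℝ) ^ s i := by
  rw [Finset.sum_congr rfl (meanTerm_eq_wordTerm (by omega) s hs a N)]
  have h := wordSum_eq_sum_chains a (blockWord (d + 1) s) 0 N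
  rw [length_blockWord _ s hs] at h
  rw [← h, wordSum_eq, Finset.range_eq_Ico, Finset.sum_eq_sum_Ico_succ_bot (by omega)]
  simp only [sum_chains_liTerm a d s hs]
  -- The mean starts at M = 0 but the kernel sum at v = 1; the extra term is an empty sum.
  have h0 : wordLi a (blockWord (d + 1) s) 0 = 0 := by simp [blockWord, wordLi]
  have hI : Finset.Ico (0 + 1) (N + 1) = Finset.Icc 1 N := by ext; simp only [Finset.mem_Ico, Finset.mem_Icc]; omega
  rw [h0, zero_add, hI, Finset.mul_sum]
  refine Finset.sum_congr rfl fun v hv => ?_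
  rw [betaKernel_zero_left (Finset.mem_Icc.1 hv).2]
  push_cast
  rw [one_div]

theorem mainTheorem7 (d : ℕ) (hd : 1 ≤ d) (s : Fin d → ℕ) (hs : ∀ i, 1 ≤ s i)
    (a : ℝ) (ha : |a| ≤ 1) (L : ℝ) (hL : HasLiStar s (onesThen d a) L) :
    HasNestedSum (meanTerm s a) L := by
  obtain ⟨d, rfl⟩ := Nat.exists_eq_add_of_le' hd
  unfold HasNestedSum
  simp only [sum_chains_meanTerm a d s hs]
  -- The mean over `range (N + 1)` is the usual Cesàro mean shifted by one.
  exact (tendsto_add_atTop_iff_nat 1).2 hL.cesaro
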